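/- Let $N$ (impression types) and $V$ (ads) be finite sets with $|N|=|V|=n$, and write $[k]=\{1,\dots,k\}$. In the i.i.d. online bipartite matching process there are $n$ stages, counted down $n,n-1,\dots,1$; in each stage one impression type, drawn independently and uniformly from $N$, appears, and it is either matched to an ad of $V$ that is still available (which is thereby used up) or discarded. Consider nonnegative variables $x_{i,j}^{t,S}$ ($i\in N$, $j\in V$, $t\in[n]$, $S\subseteq V\setminus\{j\}$, $|S|+1\ge t$), the probability that $i$ appears in stage $t$ while the set of available ads is $S\cup\{j\}$ and is matched to $j$, and $y_i^{t,S}$ ($i\in N$, $t\in[n]$, $S\subseteq V$), the probability that $i$ appears in stage $t$ while the set of available ads is $S$ and is discarded. Let $Q\subseteq\mathbb R^{n^3}$ be the polyhedron of all vectors $z=(z_{ij}^t)_{i\in N,\,j\in V,\,t\in[n]}$ of the form $z_{ij}^t=\sum_{S\subseteq V\setminus\{j\}}x_{i,j}^{t,S}$ (with $x_{i,j}^{t,S}=0$ when $|S|+1<t$) for some $x,y\ge0$ satisfying $$\sum_{j\in V}x_{i,j}^{n,V\setminus j}+y_i^{n,V}\le\frac1n\qquad(i\in N),$$ $$\sum_{j\in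 S}x_{i,j}^{t,S\setminus j}+y_i^{t,S}1_{\{t\ne1\}}-\frac1n1_{\{|S|>t\}}\sum_{k\in N}y_k^{t+1,S}-\frac1n\sum_{k\in N}\sum_{j\in V\setminus S}x_{k,j}^{t+1,S}\le0\qquad(t\in[n-1],\ i\in N,\ \emptyset\ne S\subsetneq V,\ |S|\ge t),$$ $$\sum_{j\in V}x_{i,j}^{t,V\setminus j}+y_i^{t,V}1_{\{t\ne1\}}-\frac1n\sum_{k\in N}y_k^{t+1,V}\le0\qquad(i\in N,\ t\in[n-1]).$$ For $I\subseteq N$, $J\subseteq V$ and $\tau\in[n]$ put $Z_{I,J}^\tau=\sum_{i\in I}\sum_{j\in J}z_{ij}^\tau$, and write $Z_{i,J}^\tau$ for $Z_{\{i\},J}^\tau$. A linear inequality is called facet-defining for $Q$ if every point of $Q$ satisfies it and the set of points of $Q$ that satisfy it with equality is nonempty and has dimension $\dim Q-1$ (the dimension of a set being that of its affine hull). **Theorem.** Let $h\in[2,n-1]$, $r\in[n-1]$, $t\in[n-h]$ and $q\in[0,h-2]$ be integers, let $J\subseteq V$ with $|J|=h$, let $I\subseteq N$ with $|I|=r$,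 and let $i_t,\dots,i_{t+h-q-2}\in N$ be arbitrary (repetitions allowed). Then the inequality $$r\sum_{\tau=t+h-q}^{n}Z_{N,J}^{\tau}+n\,Z_{I,J}^{t+h-q-1}+\sum_{\tau=t}^{t+h-q-2}n^{t+h-q-\tau}Z_{i_\tau,J}^{\tau}\le r(q+1)+\sum_{\tau=1}^{h-q-1}n^{h-q-\tau}$$ is facet-defining for $Q$. -/

import Mathlib

open Finset

/-- The set of stages `[n] = {1, …, n}`.  Stages are counted down: stage `t` occurs when `t`
decision epochs, including the current one, remain. -/
abbrev Stage (n : ℕ) : Type := {t : ℕ // t ∈ Icc 1 n}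

/-- The space `ℝ^{n³}` of time-indexed vectors `z = (z_{ij}^t)`, for impressions `i ∈ N`, ads
`j ∈ V` and stages `t ∈ [n]`. -/
abbrev MatchSpace (N V : Type*) (n : ℕ) : Type _ := N → V → Stage n → ℝ

/-- The constraints of the policy linear program of online bipartite matching with `n` equally
likely impression types and `n` stages, started with the set of available ads `V`.

`x i j t S` is the variable `x_{i,j}^{t,S}`: the probability that in stage `t` impression `i`
appears while the set of available ads is `S ∪ {j}`, and is matched to `j`.
`y i t S` is the variable `y_i^{t,S}`: the probability that in stage `t` impression `i` appears
while the set of available ads is `S`, and is discarded.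
Only the values of `x` and `y` at stages `t ∈ [n]`, and those of `x i j t S` with `j ∉ S`, are
variables of the program; all other values are irrelevant. -/
structure IsPolicyFeasible {N V : Type*} [Fintype N] [Fintype V] [DecidableEq V] (n : ℕ)
    (x : N → V → ℕ → Finset V → ℝ) (y : N → ℕ → Finset V → ℝ) : Prop where
  x_nonneg : ∀ i j, ∀ t ∈ Icc 1 n, ∀ S, j ∉ S → 0 ≤ x i j t S
  y_nonneg : ∀ i, ∀ t ∈ Icc 1 n, ∀ S, 0 ≤ y i t S
  /-- At most `n - t` ads have been used before stage `t`, so at least `t` ads are available in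
  stage `t`: a state with fewer ads is not a state of the process, and has no match variable. -/
  x_state : ∀ i j, ∀ t ∈ Icc 1 n, ∀ S, j ∉ S → #(insert j S) < t → x i j t S = 0
  /-- The initial stage `n`, in which all ads are available. -/
  initial : ∀ i, (∑ j, x i j n (univ.erase j)) + y i n univ ≤ 1 / (n : ℝ)
  /-- Stages `t ∈ [n - 1]` with a nonempty proper subset `S` of ads available. -/
  flow : ∀ t ∈ Icc 1 (n - 1), ∀ i, ∀ S : Finset V, S.Nonempty → S ≠ univ → t ≤ #S →
    (∑ j ∈ S, x i j t (S.erase j)) + (if t ≠ 1 then y i t S else 0)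
      - 1 / (n : ℝ) * (if t < #S then ∑ k, y k (t + 1) S else 0)
      - 1 / (n : ℝ) * ∑ k, ∑ j ∈ Sᶜ, x k j (t + 1) S ≤ 0
  /-- Stages `t ∈ [n - 1]` with all ads available. -/
  flow_univ : ∀ t ∈ Icc 1 (n - 1), ∀ i,
    (∑ j, x i j t (univ.erase j)) + (if t ≠ 1 then y i t univ else 0)
      - 1 / (n : ℝ) * ∑ k, y k (t + 1) univ ≤ 0

/-- The polyhedron `Q` of achievable matching probabilities: the projection of the feasible region
of the policy linear program under `z_{ij}^t = ∑_{S ⊆ V \ j} x_{i,j}^{t,S}`. -/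
def achievable (N V : Type*) [Fintype N] [Fintype V] [DecidableEq V] (n : ℕ) :
    Set (MatchSpace N V n) :=
  {z | ∃ (x : N → V → ℕ → Finset V → ℝ) (y : N → ℕ → Finset V → ℝ), IsPolicyFeasible n x y ∧
    ∀ i j (t : Stage n), z i j t = ∑ S ∈ (univ.erase j).powerset, x i j t S}

/-- `Z_{I,J}^τ = ∑_{i ∈ I} ∑_{j ∈ J} z_{ij}^τ`, as a linear functional of `z`
(and zero if `τ` is not a stage). -/
def Zsum {N V : Type*} {n : ℕ} (I : Finset N) (J : Finset V) (τ : ℕ) :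
    MatchSpace N V n →ₗ[ℝ] ℝ where
  toFun z := ∑ i ∈ I, ∑ j ∈ J, if hτ : τ ∈ Icc 1 n then z i j ⟨τ, hτ⟩ else 0
  map_add' z w := by
    split_ifs <;> simp [sum_add_distrib]
  map_smul' c z := by
    split_ifs <;> simp [mul_sum]

/-- The inequality `f z ≤ b` is facet-defining for `Q`: it is valid for `Q`, and the face
`{z ∈ Q | f z = b}` is nonempty and has dimension `dim Q - 1`. The dimension of a set is that of
its affine hull. -/
def IsFacetDefining {E : Type*} [AddCommGroup E] [Module ℝ E] (Q : Set E) (f : E →ₗ[ℝ] ℝ)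
    (b : ℝ) : Prop :=
  (∀ z ∈ Q, f z ≤ b) ∧ {z ∈ Q | f z = b}.Nonempty ∧
    Module.finrank ℝ (vectorSpan ℝ {z ∈ Q | f z = b}) + 1 = Module.finrank ℝ (vectorSpan ℝ Q)

/-! Read the left-hand side as the expected total reward of a policy, where matching impression `i`
in stage `τ` to any ad of `J` earns `C τ i` and all other actions earn nothing. Put `m = h - q - 1`.
The coefficients are chosen so that the dynamic program has an explicit solution: with `k` ads of
`J` left before stage `τ`, the optimal future reward is `w 1 + ... + w (min k (τ + 1 - t))`, where
`w k = n ^ (m + 1 - k)` for `k ≤ m` and `w k = r` beyond. At the initial state this is the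
right-hand side.

Validity is weak LP duality: the value function supplies multipliers for the policy constraints
(`IsPolicyFeasible.sum_mul_le`). Conversely, a policy using only actions that attain the Bellman
maximum gives a point of the face (`IsPolicy.sum_policyPoint_mul_eq`).

For the dimension, let `g` be constant on the face and subtract a multiple of the left-hand side so
that one coefficient in stage `t` vanishes. Start from the policy that randomizes over all optimal
actions and change it at one stage, state and impression. If the coefficients of `g` vanish in all
smaller-numbered (later) stages, comparing two optimal actions there equates their coefficients
(`sum_policyPoint_deviate_sub`). Enough states with ties are reachable
(`IsThresholdReward.stateProb_pos_of_min`, `IsThresholdReward.stateProb_pos_of_le`) for induction on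
the stage to kill every coefficient, so `g` was a multiple of the left-hand side. -/

/-! ### Randomized policies and the points of `Q` they induce. -/

section Policies

variable {N V : Type*}

/-- The reward of an action: `c i j τ` for a match, zero for a discard. -/
def actionReward (c : N → V → ℕ → ℝ) (i : N) (τ : ℕ) (a : Option V) : ℝ := a.elim 0 (c i · τ)

@[simp] theorem actionReward_none (c : N → V → ℕ → ℝ) (i : N) (τ : ℕ) :
    actionReward c i τ none = 0 := rfl

@[simp] theorem actionReward_some (c : N → V → ℕ → ℝ) (i : N) (τ : ℕ) (j : V) :
    actionReward c i τ (some j) = c i j τ := rfl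

theorem sum_option_eq [Fintype V] {S : Finset V} {p : Option V → ℝ} (hp : ∀ j, j ∉ S → p (some j) = 0)
    (F : Option V → ℝ) :
    ∑ a, p a * F a = p none * F none + ∑ j ∈ S, p (some j) * F (some j) := by
  rw [Fintype.sum_option]
  congr 1
  symm
  refine sum_subset (subset_univ _) fun j _ hj => ?_
  rw [hp j hj, zero_mul]

variable [DecidableEq V]

/-- The set of available ads after action `a` in state `S`; `none` is the discard action. -/
def nextState (S : Finset V) (a : Option V) : Finset V := a.elim S fun j => S.erase j

@[simp] theorem nextState_none (S : Finset V) : nextState S none = S := rfl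

@[simp] theorem nextState_some (S : Finset V) (j : V) : nextState S (some j) = S.erase j := rfl

variable [Fintype N] [Fintype V]

theorem powerset_erase_univ (j : V) :
    ((univ : Finset V).erase j).powerset = univ.filter (j ∉ ·) := by
  ext S
  simp only [mem_powerset, mem_filter, mem_univ, true_and]
  constructor
  · intro h hj
    simpa using h hj
  · intro h k hk
    simp only [mem_erase, mem_univ, and_true]
    rintro rfl
    exact h hk

theorem sum_insert_eq_sum_erase {M : Type*} [AddCommMonoid M] (j : V)
    (G : Finset V → Finset V → M) :
    ∑ S with j ∉ S, G (insert j S) S = ∑ S with j ∈ S, G S (S.erase j) := by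
  refine sum_nbij' (fun S => insert j S) (fun S => S.erase j) ?_ ?_ ?_ ?_ ?_
  · intro S _
    simp
  · intro S _
    simp
  · intro S hS
    exact erase_insert (by simpa using hS)
  · intro S hS
    exact insert_erase (by simpa using hS)
  · intro S hS
    simp only [erase_insert (by simpa using hS : j ∉ S)]

theorem sum_sum_compl_eq_sum_sum {M : Type*} [AddCommMonoid M]
    (G : V → Finset V → Finset V → M) :
    ∑ S, ∑ j ∈ Sᶜ, G j (insert j S) S = ∑ S, ∑ j ∈ S, G j S (S.erase j) := by
  have h1 : ∑ S, ∑ j ∈ Sᶜ, G j (insert j S) S = ∑ j, ∑ S with j ∉ S, G j (insert j S) S := by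
    rw [sum_comm' (t' := univ) (s' := fun j => univ.filter (j ∉ ·))]
    simp
  have h2 : ∑ S, ∑ j ∈ S, G j S (S.erase j) = ∑ j, ∑ S with j ∈ S, G j S (S.erase j) := by
    rw [sum_comm' (t' := univ) (s' := fun j => univ.filter (j ∈ ·))]
    simp
  rw [h1, h2]
  exact sum_congr rfl fun j _ => sum_insert_eq_sum_erase j (G j)

/-- `π τ S i a` is the probability of action `a` (`some j` for a match to `j`, `none` for a
discard) if impression `i` appears in stage `τ` with available ads `S`. -/
structure IsPolicy (π : ℕ → Finset V → N → Option V → ℝ) : Prop where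
  nonneg : ∀ τ S i a, 0 ≤ π τ S i a
  sum_eq_one : ∀ τ S i, ∑ a, π τ S i a = 1
  legal : ∀ τ S i j, j ∉ S → π τ S i (some j) = 0

/-- The distribution of the set of available ads after `u` stages, that is, before stage
`n - u`. -/
noncomputable def stateProb (n : ℕ) (π : ℕ → Finset V → N → Option V → ℝ) :
    ℕ → Finset V → ℝ
  | 0 => fun S => if S = univ then 1 else 0
  | u + 1 => fun S => ∑ i, (stateProb n π u S / n * π (n - u) S i none
      + ∑ j ∈ Sᶜ, stateProb n π u (insert j S) / n * π (n - u) (insert j S) i (some j))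

/-- The matching probabilities of a policy. -/
noncomputable def policyPoint (n : ℕ) (π : ℕ → Finset V → N → Option V → ℝ) :
    MatchSpace N V n :=
  fun i j t => ∑ S, stateProb n π (n - t) S / n * π t S i (some j)

variable {n : ℕ} {π : ℕ → Finset V → N → Option V → ℝ}

theorem IsPolicy.stateProb_nonneg (hπ : IsPolicy π) (u : ℕ) (S : Finset V) :
    0 ≤ stateProb n π u S := by
  induction u generalizing S with
  | zero =>
    simp only [stateProb]
    split_ifs <;> norm_num
  | succ u ih =>
    simp only [stateProb]
    refine sum_nonneg fun i _ => add_nonneg ?_ (sum_nonneg fun j _ => ?_)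
    · exact mul_nonneg (div_nonneg (ih _) n.cast_nonneg) (hπ.nonneg _ _ _ _)
    · exact mul_nonneg (div_nonneg (ih _) n.cast_nonneg) (hπ.nonneg _ _ _ _)

/-- Each stage uses at most one ad. -/
theorem stateProb_eq_zero (hV : Fintype.card V = n) {u : ℕ} {S : Finset V} (h : #S + u < n) :
    stateProb n π u S = 0 := by
  induction u generalizing S with
  | zero =>
    simp only [stateProb, ite_eq_right_iff]
    rintro rfl
    simp [hV] at h
  | succ u ih =>
    simp only [stateProb]
    refine sum_eq_zero fun i _ => ?_
    rw [ih (by omega), sum_eq_zero, zero_div, zero_mul, zero_add]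
    intro j hj
    rw [ih, zero_div, zero_mul]
    rw [card_insert_of_notMem (by simpa using hj)]
    omega

/-- The forward equation in weak form: summing over predecessors of a state is exchanged for summing
over successors. -/
theorem IsPolicy.sum_stateProb_succ (hπ : IsPolicy π) (u : ℕ) (F : Finset V → ℝ) :
    ∑ S, stateProb n π (u + 1) S * F S
      = ∑ S, stateProb n π u S / n * ∑ i, ∑ a, π (n - u) S i a * F (nextState S a) := by
  have key : ∀ i, ∑ S, ∑ j ∈ Sᶜ,
        stateProb n π u (insert j S) / n * π (n - u) (insert j S) i (some j) * F S
      = ∑ S, ∑ j ∈ S, stateProb n π u S / n * π (n - u) S i (some j) * F (S.erase j) := fun i =>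
    sum_sum_compl_eq_sum_sum fun j S S' => stateProb n π u S / n * π (n - u) S i (some j) * F S'
  simp only [stateProb, sum_mul, add_mul]
  rw [sum_comm]
  simp only [sum_add_distrib, mul_sum]
  rw [sum_congr rfl fun i _ => key i, sum_comm (s := univ (α := Finset V)) (t := univ (α := N)),
    ← sum_add_distrib]
  refine sum_congr rfl fun i _ => ?_
  rw [← sum_add_distrib]
  refine sum_congr rfl fun S _ => ?_
  rw [← mul_sum, sum_option_eq (hπ.legal _ _ _) fun a => F (nextState S a)]
  simp only [nextState_none, nextState_some, mul_add, mul_sum, mul_assoc]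

theorem IsPolicy.policyPoint_mem (hπ : IsPolicy π) (hV : Fintype.card V = n) :
    policyPoint n π ∈ achievable N V n := by
  have hp := hπ.stateProb_nonneg (n := n)
  have hmass : ∀ τ i S, (∑ j ∈ S, stateProb n π (n - τ) (insert j (S.erase j)) / n *
      π τ (insert j (S.erase j)) i (some j)) + stateProb n π (n - τ) S / n * π τ S i none
      = 1 / (n : ℝ) * stateProb n π (n - τ) S := by
    intro τ i S
    have h1 := sum_option_eq (hπ.legal τ S i) fun _ => (1 : ℝ)
    simp only [mul_one, hπ.sum_eq_one] at h1
    rw [sum_congr rfl fun j hj => by rw [insert_erase hj], ← mul_sum, ← mul_add, add_comm, ← h1]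
    ring
  -- The program omits the discard term in stage 1, so conservation of mass weakens to an inequality
  -- there.
  have hmass' : ∀ τ i S, (∑ j ∈ S, stateProb n π (n - τ) (insert j (S.erase j)) / n *
      π τ (insert j (S.erase j)) i (some j))
        + (if τ ≠ 1 then stateProb n π (n - τ) S / n * π τ S i none else 0)
      ≤ 1 / (n : ℝ) * stateProb n π (n - τ) S := by
    intro τ i S
    rw [← hmass τ i S]
    gcongr
    split_ifs
    · exact le_rfl
    · exact mul_nonneg (div_nonneg (hp _ _) n.cast_nonneg) (hπ.nonneg _ _ _ _)
  have hsucc : ∀ τ, τ ∈ Icc 1 (n - 1) → ∀ S, stateProb n π (n - τ) S =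
      ∑ i, stateProb n π (n - (τ + 1)) S / n * π (τ + 1) S i none
      + ∑ i, ∑ j ∈ Sᶜ, stateProb n π (n - (τ + 1)) (insert j S) / n *
        π (τ + 1) (insert j S) i (some j) := by
    intro τ hτ S
    rw [mem_Icc] at hτ
    rw [show n - τ = (n - (τ + 1)) + 1 by omega]
    simp only [stateProb]
    rw [sum_add_distrib, show n - (n - (τ + 1)) = τ + 1 by omega]
  refine ⟨fun i j τ S => stateProb n π (n - τ) (insert j S) / n * π τ (insert j S) i (some j),
    fun i τ S => stateProb n π (n - τ) S / n * π τ S i none, ⟨?_, ?_, ?_, ?_, ?_, ?_⟩, ?_⟩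
  · exact fun i j τ _ S _ => mul_nonneg (div_nonneg (hp _ _) n.cast_nonneg) (hπ.nonneg _ _ _ _)
  · exact fun i τ _ S => mul_nonneg (div_nonneg (hp _ _) n.cast_nonneg) (hπ.nonneg _ _ _ _)
  · intro i j τ hτ S _ hS
    rw [mem_Icc] at hτ
    rw [stateProb_eq_zero hV (by omega), zero_div, zero_mul]
  · intro i
    have := hmass n i univ
    rw [this, Nat.sub_self]
    simp [stateProb]
  · intro τ hτ i S _ _ hS
    have h1 := hmass' τ i S
    have h0 := congrArg (1 / (n : ℝ) * ·) (hsucc τ hτ S)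
    -- The indicator may be dropped: a state with at most `τ` ads has probability zero before stage
    -- `τ + 1`.
    have h2 : (if τ < #S then ∑ k, stateProb n π (n - (τ + 1)) S / n * π (τ + 1) S k none else 0)
        = ∑ k, stateProb n π (n - (τ + 1)) S / n * π (τ + 1) S k none := by
      split_ifs with h3
      · rfl
      · rw [mem_Icc] at hτ
        rw [stateProb_eq_zero hV (by omega)]
        simp
    simp only [h2]
    simp only [mul_add] at h0
    linarith
  · intro τ hτ i
    have h1 := hmass' τ i univ
    have h0 := congrArg (1 / (n : ℝ) * ·) (hsucc τ hτ univ)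
    simp only [compl_univ, sum_empty, sum_const_zero, add_zero] at h0
    linarith
  · intro i j τ
    rw [powerset_erase_univ, sum_insert_eq_sum_erase j fun S _ =>
      stateProb n π (n - τ) S / n * π τ S i (some j), policyPoint]
    symm
    refine sum_subset (subset_univ _) fun S _ hS => ?_
    rw [hπ.legal _ _ _ _ (by simpa using hS), mul_zero]

theorem sum_policyPoint_mul (c : N → V → Stage n → ℝ) :
    ∑ i, ∑ j, ∑ t, policyPoint n π i j t * c i j t
      = ∑ t : Stage n, ∑ S, stateProb n π (n - t) S / n *
          ∑ i, ∑ j, π t S i (some j) * c i j t := by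
  simp only [policyPoint, sum_mul, mul_sum, mul_assoc]
  calc _ = ∑ i, ∑ t : Stage n, ∑ j, ∑ S, stateProb n π (n - t) S / n *
            (π t S i (some j) * c i j t) := sum_congr rfl fun i _ => sum_comm
    _ = ∑ t : Stage n, ∑ i, ∑ j, ∑ S, stateProb n π (n - t) S / n *
            (π t S i (some j) * c i j t) := sum_comm
    _ = _ := by
      refine sum_congr rfl fun t _ => ?_
      rw [sum_comm (s := univ (α := Finset V))]
      exact sum_congr rfl fun i _ => sum_comm

theorem sum_stage_eq_sum_range (F : ℕ → ℝ) :
    ∑ t : Stage n, F t = ∑ k ∈ range n, F (k + 1) := by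
  rw [sum_coe_sort (Icc 1 n) F]
  rw [range_eq_Ico, sum_Ico_add' F 0 n 1]
  rfl

/-- If every action in the support attains the Bellman value, the expected reward of a stage equals
the drop in the expectation of `Φ`, and the sum telescopes. -/
theorem IsPolicy.sum_policyPoint_mul_eq (hπ : IsPolicy π) (hn : n ≠ 0) {c : N → V → ℕ → ℝ}
    {Φ : ℕ → Finset V → ℝ} {v : ℕ → Finset V → N → ℝ} (h0 : ∀ S, Φ 0 S = 0)
    (hv : ∀ τ S, 1 ≤ τ → τ ≤ n → ∑ i, v τ S i = n * Φ τ S)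
    (hbest : ∀ τ S i a, 1 ≤ τ → τ ≤ n → π τ S i a ≠ 0 →
      actionReward c i τ a + Φ (τ - 1) (nextState S a) = v τ S i) :
    ∑ i, ∑ j, ∑ t : Stage n, policyPoint n π i j t * c i j t = Φ n univ := by
  rw [sum_policyPoint_mul fun i j (t : Stage n) => c i j t,
    sum_stage_eq_sum_range fun τ => ∑ S, stateProb n π (n - τ) S / n *
      ∑ i, ∑ j, π τ S i (some j) * c i j τ]
  have hn' : (n : ℝ) ≠ 0 := by exact_mod_cast hn
  have step : ∀ k ∈ range n, ∑ S, stateProb n π (n - (k + 1)) S / n *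
      ∑ i, ∑ j, π (k + 1) S i (some j) * c i j (k + 1)
      = ∑ S, stateProb n π (n - (k + 1)) S * Φ (k + 1) S
        - ∑ S, stateProb n π (n - k) S * Φ k S := by
    intro k hk
    rw [mem_range] at hk
    rw [show n - k = (n - (k + 1)) + 1 by omega, hπ.sum_stateProb_succ,
      show n - (n - (k + 1)) = k + 1 by omega, ← sum_sub_distrib]
    refine sum_congr rfl fun S _ => ?_
    have h1 : ∀ i, ∑ j, π (k + 1) S i (some j) * c i j (k + 1)
        = v (k + 1) S i - ∑ a, π (k + 1) S i a * Φ k (nextState S a) := by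
      intro i
      have h2 : v (k + 1) S i = ∑ a, π (k + 1) S i a * v (k + 1) S i := by
        rw [← sum_mul, hπ.sum_eq_one, one_mul]
      have h3 : ∑ j, π (k + 1) S i (some j) * c i j (k + 1)
          = ∑ a, π (k + 1) S i a * actionReward c i (k + 1) a := by
        simp [Fintype.sum_option]
      rw [h2, h3, ← sum_sub_distrib]
      refine sum_congr rfl fun a _ => ?_
      by_cases ha : π (k + 1) S i a = 0
      · simp [ha]
      · have := hbest (k + 1) S i a (by omega) (by omega) ha
        rw [Nat.add_sub_cancel] at this
        rw [← this]
        ring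
    rw [sum_congr rfl fun i _ => h1 i, sum_sub_distrib, hv _ _ (by omega) (by omega)]
    field_simp
  rw [sum_congr rfl step, sum_range_sub fun k => ∑ S, stateProb n π (n - k) S * Φ k S]
  simp [h0, stateProb]

end Policies

/-! ### Weak duality for the policy linear program. -/

section Duality

variable {N V : Type*} [Fintype N] [Fintype V] [DecidableEq V]

/-- The bound on `n` times the probability of state `S` in stage `τ` that the constraints of the
policy linear program impose. -/
noncomputable def inflow (n : ℕ) (x : N → V → ℕ → Finset V → ℝ) (y : N → ℕ → Finset V → ℝ)
    (τ : ℕ) (S : Finset V) : ℝ :=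
  if τ = n then (if S = univ then 1 else 0)
  else (if τ < #S then ∑ k, y k (τ + 1) S else 0) + ∑ k, ∑ j ∈ Sᶜ, x k j (τ + 1) S

variable {n : ℕ} {x : N → V → ℕ → Finset V → ℝ} {y : N → ℕ → Finset V → ℝ}

theorem IsPolicyFeasible.inflow_nonneg (h : IsPolicyFeasible n x y) {τ : ℕ} (hτ : τ ≤ n)
    (S : Finset V) : 0 ≤ inflow n x y τ S := by
  unfold inflow
  split_ifs with h1 h2 h3
  · norm_num
  · norm_num
  · refine add_nonneg (sum_nonneg fun k _ => h.y_nonneg _ _ ?_ _)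
      (sum_nonneg fun k _ => sum_nonneg fun j hj => h.x_nonneg _ _ _ ?_ _ (by simpa using hj))
    all_goals rw [mem_Icc]; omega
  · refine add_nonneg le_rfl
      (sum_nonneg fun k _ => sum_nonneg fun j hj => h.x_nonneg _ _ _ ?_ _ (by simpa using hj))
    rw [mem_Icc]; omega

/-- A uniform form of the three families of constraints. Discards with `#S < τ` occur in no
constraint and are left out, as are those of stage 1. -/
theorem IsPolicyFeasible.mass_le (h : IsPolicyFeasible n x y) (hV : Fintype.card V = n) {τ : ℕ}
    (h1 : 1 ≤ τ) (hn : τ ≤ n) (i : N) (S : Finset V) :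
    ∑ j ∈ S, x i j τ (S.erase j) + (if τ ≠ 1 then (if τ ≤ #S then y i τ S else 0) else 0)
      ≤ 1 / (n : ℝ) * inflow n x y τ S := by
  by_cases hS : τ ≤ #S
  · rw [if_pos hS]
    by_cases hu : S = univ
    · subst hu
      by_cases hτ : τ = n
      · have h2 := h.initial i
        have h3 : 0 ≤ y i n univ := h.y_nonneg _ _ (by rw [mem_Icc]; omega) _
        subst hτ
        simp only [inflow, if_true, mul_one]
        split_ifs
        · exact h2
        · linarith
      · have h2 := h.flow_univ τ (by rw [mem_Icc]; omega) i
        simp only [inflow, if_neg hτ, compl_univ, sum_empty, sum_const_zero, add_zero]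
        rw [if_pos (show τ < #(univ : Finset V) by rw [card_univ, hV]; omega)]
        linarith
    · have h3 : #S < n := by
        rw [← hV]
        exact (card_lt_iff_ne_univ S).2 hu
      have h2 := h.flow τ (by rw [mem_Icc]; omega) i S (card_pos.1 (by omega)) hu hS
      rw [inflow, if_neg (show τ ≠ n by omega), mul_add]
      linarith
  · rw [sum_eq_zero, if_neg hS, ite_self, add_zero]
    · exact mul_nonneg (by positivity) (h.inflow_nonneg hn S)
    · intro j hj
      refine h.x_state _ _ _ (by rw [mem_Icc]; omega) _ (notMem_erase _ _) ?_
      rw [insert_erase hj]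
      omega

/-- The constraint for `(τ, S, i)` gets multiplier `v τ S i`, which dominates the reward plus
continuation value of each action; the sums of `inflow` times `Φ` then telescope. -/
theorem IsPolicyFeasible.sum_mul_le (h : IsPolicyFeasible n x y) (hV : Fintype.card V = n)
    (hn : n ≠ 0) {c : N → V → ℕ → ℝ} {Φ : ℕ → Finset V → ℝ} {v : ℕ → Finset V → N → ℝ}
    (h0 : ∀ S, Φ 0 S = 0)
    (hv : ∀ τ S, 1 ≤ τ → τ ≤ n → ∑ i, v τ S i = n * Φ τ S) (hpos : ∀ τ S i, 0 ≤ v τ S i)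
    (hnone : ∀ τ S i, Φ (τ - 1) S ≤ v τ S i)
    (hsome : ∀ τ S i j, 1 ≤ τ → τ ≤ n → j ∈ S → c i j τ + Φ (τ - 1) (S.erase j) ≤ v τ S i) :
    ∑ i, ∑ j, ∑ t : Stage n, (∑ S ∈ (univ.erase j).powerset, x i j t S) * c i j t
      ≤ Φ n univ := by
  have hn' : (n : ℝ) ≠ 0 := by exact_mod_cast hn
  have e1 : ∀ (i : N) (t : Stage n), ∑ j, (∑ S ∈ (univ.erase j).powerset, x i j t S) * c i j t
      = ∑ S, ∑ j ∈ S, x i j t (S.erase j) * c i j t := by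
    intro i t
    rw [← sum_sum_compl_eq_sum_sum fun j _ S' => x i j t S' * c i j t,
      sum_comm' (t' := univ) (s' := fun j => univ.filter (j ∉ ·)) (by simp)]
    refine sum_congr rfl fun j _ => ?_
    rw [powerset_erase_univ, sum_mul]
  have e2 : ∑ i, ∑ j, ∑ t : Stage n, (∑ S ∈ (univ.erase j).powerset, x i j t S) * c i j t
      = ∑ t : Stage n, ∑ S, ∑ i, ∑ j ∈ S, x i j t (S.erase j) * c i j t := by
    calc _ = ∑ i, ∑ t : Stage n, ∑ j, (∑ S ∈ (univ.erase j).powerset, x i j t S) * c i j t :=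
          sum_congr rfl fun i _ => sum_comm
      _ = ∑ t : Stage n, ∑ i, ∑ j, (∑ S ∈ (univ.erase j).powerset, x i j t S) * c i j t :=
          sum_comm
      _ = _ := by
        refine sum_congr rfl fun t _ => ?_
        rw [sum_congr rfl fun i _ => e1 i t, sum_comm]
  rw [e2, sum_stage_eq_sum_range fun τ => ∑ S, ∑ i, ∑ j ∈ S, x i j τ (S.erase j) * c i j τ]
  have step : ∀ k ∈ range n, ∑ S, ∑ i, ∑ j ∈ S, x i j (k + 1) (S.erase j) * c i j (k + 1)
      ≤ ∑ S, inflow n x y (k + 1) S * Φ (k + 1) S - ∑ S, inflow n x y k S * Φ k S := by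
    intro k hk
    rw [mem_range] at hk
    have e3 : ∑ S, inflow n x y k S * Φ k S
        = ∑ S, ∑ i, ((if k + 1 ≤ #S then y i (k + 1) S else 0) * Φ k S
          + ∑ j ∈ S, x i j (k + 1) (S.erase j) * Φ k (S.erase j)) := by
      have e4 : ∀ i, ∑ S, ∑ j ∈ Sᶜ, x i j (k + 1) S * Φ k S
          = ∑ S, ∑ j ∈ S, x i j (k + 1) (S.erase j) * Φ k (S.erase j) := fun i =>
        sum_sum_compl_eq_sum_sum fun j _ S' => x i j (k + 1) S' * Φ k S'
      simp only [inflow, if_neg hk.ne, add_mul, sum_mul, sum_add_distrib]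
      congr 1
      · refine sum_congr rfl fun S _ => ?_
        by_cases hkS : k < #S
        · simp [hkS, Nat.succ_le_of_lt hkS, sum_mul]
        · simp [hkS]
      · rw [sum_comm, sum_congr rfl fun i _ => e4 i, sum_comm]
    rw [e3, le_sub_iff_add_le, ← sum_add_distrib]
    refine sum_le_sum fun S _ => ?_
    rw [← sum_add_distrib]
    have e5 : inflow n x y (k + 1) S * Φ (k + 1) S
        = ∑ i, 1 / (n : ℝ) * inflow n x y (k + 1) S * v (k + 1) S i := by
      rw [← mul_sum, hv _ _ (by omega) (by omega)]
      field_simp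
    rw [e5]
    refine sum_le_sum fun i _ => ?_
    refine le_trans ?_ (mul_le_mul_of_nonneg_right
      (h.mass_le hV (by omega : 1 ≤ k + 1) (by omega) i S) (hpos _ _ _))
    rw [add_mul, sum_mul, add_left_comm, ← sum_add_distrib, add_comm]
    refine add_le_add (sum_le_sum fun j hj => ?_) ?_
    · rw [← mul_add]
      refine mul_le_mul_of_nonneg_left ?_
        (h.x_nonneg _ _ _ (by rw [mem_Icc]; omega) _ (notMem_erase _ _))
      simpa using hsome (k + 1) S i j (by omega) (by omega) hj
    · have hy : 0 ≤ y i (k + 1) S := h.y_nonneg _ _ (by rw [mem_Icc]; omega) _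
      have hΦ := hnone (k + 1) S i
      rw [Nat.add_sub_cancel] at hΦ
      -- In stage 1 discards are not bounded by the program, but they lead to value `Φ 0 = 0`.
      rcases Nat.eq_zero_or_pos k with rfl | hk0
      · simp [h0]
      · rw [if_pos (by omega : k + 1 ≠ 1)]
        refine mul_le_mul_of_nonneg_left hΦ ?_
        split_ifs
        · exact hy
        · exact le_rfl
  refine (sum_le_sum step).trans ?_
  rw [sum_range_sub fun k => ∑ S, inflow n x y k S * Φ k S]
  simp [h0, inflow]

theorem zero_mem_achievable : (0 : MatchSpace N V n) ∈ achievable N V n := by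
  refine ⟨fun _ _ _ _ => 0, fun _ _ _ => 0, ⟨?_, ?_, ?_, ?_, ?_, ?_⟩, ?_⟩ <;> simp

end Duality

/-! ### Changing a policy at a single stage, state and impression. -/

section Deviation

variable {N V : Type*} [Fintype V] [DecidableEq V]

open Classical in
/-- The policy that takes action `a` if impression `i` appears in stage `τ` and state `S`, and
follows `π` otherwise. -/
noncomputable def deviate (π : ℕ → Finset V → N → Option V → ℝ) (τ : ℕ) (S : Finset V) (i : N)
    (a : Option V) : ℕ → Finset V → N → Option V → ℝ :=
  fun τ' S' i' b =>
    if τ' = τ ∧ S' = S ∧ i' = i then (if b = a then 1 else 0) else π τ' S' i' b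

variable {n : ℕ} {π : ℕ → Finset V → N → Option V → ℝ} {τ : ℕ} {S : Finset V} {i : N}
  {a : Option V}

theorem IsPolicy.deviate (hπ : IsPolicy π) (ha : ∀ j, a = some j → j ∈ S) :
    IsPolicy (deviate π τ S i a) := by
  refine ⟨fun τ' S' i' b => ?_, fun τ' S' i' => ?_, fun τ' S' i' j hj => ?_⟩
  · unfold _root_.deviate
    split_ifs
    · exact zero_le_one
    · exact le_rfl
    · exact hπ.nonneg _ _ _ _
  · unfold _root_.deviate
    split_ifs
    · simp
    · exact hπ.sum_eq_one _ _ _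
  · unfold _root_.deviate
    split_ifs with h1 h2
    · exact absurd (h1.2.1 ▸ ha j h2.symm) hj
    · rfl
    · exact hπ.legal _ _ _ _ hj

variable [Fintype N]

theorem stateProb_deviate {u : ℕ} (hu : u + τ ≤ n) :
    stateProb n (deviate π τ S i a) u = stateProb n π u := by
  induction u with
  | zero => rfl
  | succ u ih =>
    have h1 : n - u ≠ τ := by omega
    ext S'
    simp only [stateProb, ih (by omega), deviate, h1, false_and, if_false]

/-- The deviation does not affect the state distribution up to stage `τ`, and later stages carry no
weight under `c`, so only the immediate action counts. -/
theorem sum_policyPoint_deviate_sub {τ : Stage n} {a' : Option V} (c : N → V → Stage n → ℝ)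
    (hc : ∀ i j (t : Stage n), (t : ℕ) < τ → c i j t = 0) :
    (∑ i', ∑ j, ∑ t, policyPoint n (deviate π τ S i a) i' j t * c i' j t)
      - ∑ i', ∑ j, ∑ t, policyPoint n (deviate π τ S i a') i' j t * c i' j t
      = stateProb n π (n - τ) S / n * (a.elim 0 (c i · τ) - a'.elim 0 (c i · τ)) := by
  classical
  have hτ := τ.2
  rw [mem_Icc] at hτ
  rw [sum_policyPoint_mul, sum_policyPoint_mul, ← sum_sub_distrib, sum_eq_single τ]
  · rw [← sum_sub_distrib, sum_eq_single S]
    · rw [stateProb_deviate (by omega), stateProb_deviate (by omega), ← mul_sub,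
        ← sum_sub_distrib, sum_eq_single i]
      · congr 2
        · cases a <;> simp [deviate]
        · cases a' <;> simp [deviate]
      · intro i' _ hi
        simp [deviate, hi]
      · simp
    · intro S' _ hS
      rw [stateProb_deviate (by omega), stateProb_deviate (by omega)]
      simp [deviate, hS]
    · simp
  · intro t _ ht
    have ht' : (t : ℕ) ≠ τ := fun h => ht (Subtype.ext h)
    rcases lt_or_gt_of_ne ht' with hlt | hgt
    · simp [hc _ _ t hlt]
    · have h2 := t.2
      rw [mem_Icc] at h2
      rw [stateProb_deviate (by omega), stateProb_deviate (by omega)]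
      simp [deviate, ht']
  · simp

end Deviation

/-! ### A dual criterion for facets. -/

section Facet

/-- The face of a set cut out by `f = b` has the dimension of a facet if every functional that is
constant on it is a multiple of `f`. -/
theorem isFacetDefining_of_dual {E : Type*} [AddCommGroup E] [Module ℝ E] [FiniteDimensional ℝ E]
    {Q : Set E} {f : E →ₗ[ℝ] ℝ} {b : ℝ} (hb : b ≠ 0) (h0 : (0 : E) ∈ Q)
    (hle : ∀ z ∈ Q, f z ≤ b) (hne : {z ∈ Q | f z = b}.Nonempty)
    (hdual : ∀ g : Module.Dual ℝ E,
      (∀ z ∈ {z ∈ Q | f z = b}, ∀ w ∈ {z ∈ Q | f z = b}, g z = g w) → ∃ a : ℝ, g = a • f) :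
    IsFacetDefining Q f b := by
  refine ⟨hle, hne, ?_⟩
  obtain ⟨z₀, hz₀, hfz₀⟩ := hne
  have hf : f ≠ 0 := by
    rintro rfl
    exact hb (by simpa using hfz₀.symm)
  have hann : ∀ (s : Set E) (g : Module.Dual ℝ E), g ∈ (vectorSpan ℝ s).dualAnnihilator ↔
      ∀ z ∈ s, ∀ w ∈ s, g z = g w := by
    intro s g
    rw [Submodule.mem_dualAnnihilator]
    constructor
    · intro h z hz w hw
      have := h _ (vsub_mem_vectorSpan ℝ hz hw)
      rw [vsub_eq_sub, map_sub] at this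
      linarith
    · intro h z hz
      have hle : vectorSpan ℝ s ≤ LinearMap.ker g := by
        rw [vectorSpan, Submodule.span_le]
        rintro _ ⟨z, hz, w, hw, rfl⟩
        simp [h z hz w hw]
      exact hle hz
  have h1 : (vectorSpan ℝ {z ∈ Q | f z = b}).dualAnnihilator = Submodule.span ℝ {f} := by
    ext g
    rw [hann, Submodule.mem_span_singleton]
    constructor
    · intro h
      obtain ⟨a, rfl⟩ := hdual g h
      exact ⟨a, rfl⟩
    · rintro ⟨a, rfl⟩ z hz w hw
      simp [hz.2, hw.2]
  -- `Q` is full-dimensional: a functional constant on `Q` is some `a • f`, and comparing `z₀` with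
  -- `0` gives `a * b = 0`.
  have h2 : (vectorSpan ℝ Q).dualAnnihilator = ⊥ := by
    rw [eq_bot_iff]
    intro g hg
    rw [hann] at hg
    obtain ⟨a, rfl⟩ := hdual g fun z hz w hw => hg z hz.1 w hw.1
    have := hg z₀ hz₀ 0 h0
    have ha : a = 0 := by simpa [hfz₀, hb] using this
    simp [ha]
  have h3 := Subspace.finrank_add_finrank_dualAnnihilator_eq (vectorSpan ℝ {z ∈ Q | f z = b})
  have h4 := Subspace.finrank_add_finrank_dualAnnihilator_eq (vectorSpan ℝ Q)
  rw [h1, finrank_span_singleton (by exact hf)] at h3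
  rw [h2, finrank_bot] at h4
  omega

theorem linearMap_matchSpace_apply {N V : Type*} [Fintype N] [Fintype V] [DecidableEq N]
    [DecidableEq V] {n : ℕ} (g : MatchSpace N V n →ₗ[ℝ] ℝ) (z : MatchSpace N V n) :
    g z = ∑ i, ∑ j, ∑ t, z i j t * g (Pi.single i (Pi.single j (Pi.single t 1))) := by
  have h : z = ∑ i, ∑ j, ∑ t, z i j t •
      (Pi.single i (Pi.single j (Pi.single t 1)) : MatchSpace N V n) := by
    ext i j t
    simp only [Finset.sum_apply, Pi.smul_apply, smul_eq_mul]
    rw [sum_eq_single i, sum_eq_single j, sum_eq_single t]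
    · simp
    · intro t' _ h
      simp [h.symm]
    · simp
    · intro j' _ h
      simp [h.symm]
    · simp
    · intro i' _ h
      simp [h.symm]
    · simp
  conv_lhs => rw [h]
  simp only [map_sum, map_smul, smul_eq_mul]

end Facet

/-! ### Policies with prescribed support, and reachability of states. -/

section Support

variable {N V : Type*} [Fintype V]

open Classical in
/-- The policy that chooses uniformly among the actions allowed by `O`. -/
noncomputable def uniformPolicy (O : ℕ → Finset V → N → Option V → Prop) :
    ℕ → Finset V → N → Option V → ℝ :=
  fun τ S i a => if O τ S i a then (#{b | O τ S i b} : ℝ)⁻¹ else 0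

variable {O : ℕ → Finset V → N → Option V → Prop}

theorem uniformPolicy_pos {τ : ℕ} {S : Finset V} {i : N} {a : Option V} (h : O τ S i a) :
    0 < uniformPolicy O τ S i a := by
  classical
  rw [uniformPolicy, if_pos h, inv_pos, Nat.cast_pos, card_pos]
  exact ⟨a, by simpa using h⟩

theorem of_uniformPolicy_ne_zero {τ : ℕ} {S : Finset V} {i : N} {a : Option V}
    (h : uniformPolicy O τ S i a ≠ 0) : O τ S i a := by
  by_contra hO
  exact h (if_neg hO)

theorem isPolicy_uniformPolicy (hne : ∀ τ S i, ∃ a, O τ S i a)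
    (hlegal : ∀ τ S i j, O τ S i (some j) → j ∈ S) : IsPolicy (uniformPolicy O) := by
  classical
  refine ⟨fun τ S i a => ?_, fun τ S i => ?_, fun τ S i j hj => ?_⟩
  · unfold uniformPolicy
    split_ifs <;> positivity
  · obtain ⟨a, ha⟩ := hne τ S i
    simp only [uniformPolicy]
    rw [← sum_filter, sum_const, nsmul_eq_mul]
    refine mul_inv_cancel₀ ?_
    rw [Nat.cast_ne_zero, ← Nat.pos_iff_ne_zero, card_pos]
    exact ⟨a, by simpa using ha⟩
  · exact if_neg fun h => hj (hlegal _ _ _ _ h)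

variable [Fintype N] [DecidableEq V] {n : ℕ} {π : ℕ → Finset V → N → Option V → ℝ}

theorem IsPolicy.stateProb_succ_pos (hπ : IsPolicy π) (hn : n ≠ 0) {u : ℕ} {S : Finset V} {i : N}
    {a : Option V} (hS : 0 < stateProb n π u S) (ha : 0 < π (n - u) S i a) :
    0 < stateProb n π (u + 1) (nextState S a) := by
  have hn' : (0 : ℝ) < n := by exact_mod_cast Nat.pos_of_ne_zero hn
  -- Testing against the indicator of the successor state turns its probability into a sum of
  -- nonnegative terms.
  have h1 := hπ.sum_stateProb_succ (n := n) u fun S' => if S' = nextState S a then 1 else 0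
  simp only [mul_ite, mul_one, mul_zero, sum_ite_eq', mem_univ, if_true] at h1
  have hterm : ∀ S' i' b, 0 ≤ if nextState S' b = nextState S a then π (n - u) S' i' b else 0 := by
    intro S' i' b
    split_ifs
    · exact hπ.nonneg _ _ _ _
    · exact le_rfl
  rw [h1]
  refine sum_pos' (fun S' _ => mul_nonneg (div_nonneg (hπ.stateProb_nonneg _ _) hn'.le)
    (sum_nonneg fun i' _ => sum_nonneg fun b _ => hterm _ _ _)) ⟨S, mem_univ _, ?_⟩
  refine mul_pos (div_pos hS hn') (sum_pos' (fun i' _ => sum_nonneg fun b _ => hterm _ _ _)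
    ⟨i, mem_univ _, sum_pos' (fun b _ => hterm _ _ _) ⟨a, mem_univ _, ?_⟩⟩)
  simpa using ha

end Support

/-! ### Threshold rewards and their explicit value function. -/

/-- Rewards `C τ i` for matching impression `i` in stage `τ` to one of `h` distinguished ads, for
which the `k`-th remaining distinguished ad has value `w k` in every stage `τ ≥ t + k - 1`, and
no value in the stages `τ < t + k - 1`. -/
structure IsThresholdReward {N : Type*} [Fintype N] (n t m h : ℕ) (w : ℕ → ℝ) (C : ℕ → N → ℝ) :
    Prop where
  nonneg : ∀ τ i, 0 ≤ C τ i
  early : ∀ τ i, τ < t → C τ i = 0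
  sum_eq : ∀ τ, t ≤ τ → ∑ i, C τ i = n * w (τ + 1 - t)
  le : ∀ τ i k, 1 ≤ k → k + t ≤ τ → C τ i ≤ w k
  exists_tie : ∀ τ, t < τ → ∃ i, C τ i = w (min h (τ - t))
  exists_zero : ∀ τ, τ ≤ t + m → ∃ i, C τ i = 0
  tie_or_zero : ∀ τ i, t < τ → C τ i = w (min h (τ - t)) ∨ C τ i = 0 ∧ τ ≤ t + m
  exists_pivot : ∃ i₀, C t i₀ ≠ 0 ∧ ∀ i, i ≠ i₀ → C t i = 0

section Threshold

variable {N V : Type*} [DecidableEq V]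

/-- The value of the set of available ads `S` before stage `τ`. -/
def potential (t : ℕ) (w : ℕ → ℝ) (J : Finset V) (τ : ℕ) (S : Finset V) : ℝ :=
  ∑ u ∈ range (min #(S ∩ J) (τ + 1 - t)), w (u + 1)

/-- The value of the set of available ads `S` in stage `τ` once impression `i` has appeared. -/
def stateValue (t : ℕ) (w : ℕ → ℝ) (C : ℕ → N → ℝ) (J : Finset V) (τ : ℕ) (S : Finset V)
    (i : N) : ℝ :=
  (∑ u ∈ range (min #(S ∩ J) (τ - t)), w (u + 1)) + if τ + 1 - t ≤ #(S ∩ J) then C τ i else 0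

/-- The reward of matching impression `i` to ad `j` in stage `τ`. -/
def matchReward (C : ℕ → N → ℝ) (J : Finset V) (i : N) (j : V) (τ : ℕ) : ℝ :=
  if j ∈ J then C τ i else 0

/-- The legal actions that attain the value of a state. -/
def IsOptimal (t : ℕ) (w : ℕ → ℝ) (C : ℕ → N → ℝ) (J : Finset V) (τ : ℕ) (S : Finset V) (i : N)
    (a : Option V) : Prop :=
  (∀ j, a = some j → j ∈ S) ∧
    actionReward (matchReward C J) i τ a + potential t w J (τ - 1) (nextState S a)
      = stateValue t w C J τ S i

variable {t : ℕ} {w : ℕ → ℝ} {C : ℕ → N → ℝ} {J S : Finset V} {τ : ℕ} {i : N} {j : V}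

theorem potential_pred (ht : 1 ≤ t) :
    potential t w J (τ - 1) S = ∑ u ∈ range (min #(S ∩ J) (τ - t)), w (u + 1) := by
  rw [potential, show τ - 1 + 1 - t = τ - t by omega]

theorem card_erase_inter_of_mem (hS : j ∈ S) (hJ : j ∈ J) : #(S.erase j ∩ J) + 1 = #(S ∩ J) := by
  rw [erase_inter, card_erase_add_one (mem_inter.2 ⟨hS, hJ⟩)]

theorem card_erase_inter_of_notMem (hJ : j ∉ J) : #(S.erase j ∩ J) = #(S ∩ J) := by
  rw [erase_inter, erase_eq_of_notMem fun h => hJ (mem_inter.1 h).2]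

theorem isOptimal_none (ht : 1 ≤ t) (h : τ + 1 - t ≤ #(S ∩ J) → C τ i = 0) :
    IsOptimal t w C J τ S i none := by
  refine ⟨by simp, ?_⟩
  rw [actionReward_none, nextState_none, potential_pred ht, stateValue, zero_add,
    left_eq_add, ite_eq_right_iff]
  exact h

theorem isOptimal_some_of_notMem (ht : 1 ≤ t) (h : τ + 1 - t ≤ #(S ∩ J) → C τ i = 0)
    (hS : j ∈ S) (hJ : j ∉ J) : IsOptimal t w C J τ S i (some j) := by
  refine ⟨by simpa using hS, ?_⟩
  rw [actionReward_some, nextState_some, potential_pred ht, stateValue, matchReward, if_neg hJ,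
    zero_add, card_erase_inter_of_notMem hJ, left_eq_add, ite_eq_right_iff]
  exact h

/-- With at least `τ + 1 - t` distinguished ads, the later stages that can still earn are fewer than
the ads, so giving one up costs nothing. -/
theorem isOptimal_some_of_le (ht : 1 ≤ t) (h : τ + 1 - t ≤ #(S ∩ J))
    (hS : j ∈ S) (hJ : j ∈ J) : IsOptimal t w C J τ S i (some j) := by
  refine ⟨by simpa using hS, ?_⟩
  have h1 := card_erase_inter_of_mem hS hJ
  rw [actionReward_some, nextState_some, potential_pred ht, stateValue, matchReward, if_pos hJ,
    if_pos h, add_comm, min_eq_right (by omega), min_eq_right (by omega)]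

/-- Here the match gives up the last summand `w #(S ∩ J)` of the potential and earns exactly that
amount. -/
theorem isOptimal_some_of_tie (ht : 1 ≤ t) (h : #(S ∩ J) ≤ τ - t) (hC : C τ i = w #(S ∩ J))
    (hS : j ∈ S) (hJ : j ∈ J) : IsOptimal t w C J τ S i (some j) := by
  refine ⟨by simpa using hS, ?_⟩
  have h1 := card_erase_inter_of_mem hS hJ
  rw [actionReward_some, nextState_some, potential_pred ht, stateValue, matchReward, if_pos hJ,
    if_neg (by omega), min_eq_left (by omega), min_eq_left (by omega), hC, ← h1, sum_range_succ]
  ring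

theorem exists_isOptimal (ht : 1 ≤ t) (hC : ∀ τ i, τ < t → C τ i = 0) (τ : ℕ) (S : Finset V)
    (i : N) : ∃ a, IsOptimal t w C J τ S i a := by
  by_cases h : τ + 1 - t ≤ #(S ∩ J) → C τ i = 0
  · exact ⟨none, isOptimal_none ht h⟩
  · push Not at h
    have h1 : t ≤ τ := by
      by_contra h2
      exact h.2 (hC _ _ (by omega))
    obtain ⟨j, hj⟩ := card_pos.1 (by omega : 0 < #(S ∩ J))
    rw [mem_inter] at hj
    exact ⟨some j, isOptimal_some_of_le ht h.1 hj.1 hj.2⟩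

variable [Fintype N] {n m h : ℕ}

namespace IsThresholdReward

theorem weight_nonneg (hC : IsThresholdReward n t m h w C)
    (k : ℕ) (hk : 1 ≤ k) : 0 ≤ w k := by
  obtain ⟨i, -⟩ := hC.exists_pivot
  exact (hC.nonneg (k + t) i).trans (hC.le _ _ _ hk le_rfl)

theorem stateValue_nonneg (hC : IsThresholdReward n t m h w C)
    (τ : ℕ) (S : Finset V) (i : N) : 0 ≤ stateValue t w C J τ S i := by
  refine add_nonneg (sum_nonneg fun u _ => hC.weight_nonneg _ (by omega)) ?_
  split_ifs
  · exact hC.nonneg _ _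
  · exact le_rfl

theorem potential_le_stateValue (hC : IsThresholdReward n t m h w C)
    (ht : 1 ≤ t) (τ : ℕ) (S : Finset V) (i : N) :
    potential t w J (τ - 1) S ≤ stateValue t w C J τ S i := by
  rw [potential_pred ht, stateValue, le_add_iff_nonneg_right]
  split_ifs
  · exact hC.nonneg _ _
  · exact le_rfl

/-- Either distinguished ads abound and the match is free, or `#(S ∩ J) ≤ τ - t` and the ad given up
is worth at least `C τ i` by the field `le`. -/
theorem matchReward_add_le (hC : IsThresholdReward n t m h w C)
    (ht : 1 ≤ t) (τ : ℕ) (S : Finset V) (i : N) (j : V) (hj : j ∈ S) :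
    matchReward C J i j τ + potential t w J (τ - 1) (S.erase j) ≤ stateValue t w C J τ S i := by
  by_cases hJ : j ∈ J
  · by_cases h : τ + 1 - t ≤ #(S ∩ J)
    · exact (isOptimal_some_of_le ht h hj hJ).2.le
    · have h1 := card_erase_inter_of_mem hj hJ
      rw [potential_pred ht, stateValue, matchReward, if_pos hJ, if_neg h,
        min_eq_left (by omega), min_eq_left (by omega), ← h1, sum_range_succ]
      have := hC.le τ i (#(S.erase j ∩ J) + 1) (by omega) (by omega)
      linarith
  · rw [matchReward, if_neg hJ, zero_add, potential_pred ht, card_erase_inter_of_notMem hJ,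
      ← potential_pred ht]
    exact hC.potential_le_stateValue ht _ _ _

/-- The Bellman equation. When distinguished ads abound, the field `sum_eq` makes the average reward
equal to the extra summand `w (τ + 1 - t)`. -/
theorem sum_stateValue (hC : IsThresholdReward n t m h w C)
    (hN : Fintype.card N = n) (τ : ℕ) (S : Finset V) :
    ∑ i, stateValue t w C J τ S i = n * potential t w J τ S := by
  simp only [stateValue, sum_add_distrib, sum_const, card_univ, hN, nsmul_eq_mul]
  rw [potential]
  by_cases h : τ + 1 - t ≤ #(S ∩ J)
  · simp only [if_pos h]
    rw [min_eq_right (by omega), min_eq_right h]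
    by_cases hτ : t ≤ τ
    · rw [hC.sum_eq _ hτ, show τ + 1 - t = τ - t + 1 by omega, sum_range_succ]
      ring
    · rw [sum_eq_zero fun i _ => hC.early τ i (by omega), show τ - t = 0 by omega,
        show τ + 1 - t = 0 by omega, add_zero]
  · simp only [if_neg h]
    rw [min_eq_left (by omega), min_eq_left (by omega), sum_const_zero, add_zero]

end IsThresholdReward

end Threshold

/-! ### Reachable ties and the facet property for threshold rewards. -/

section Main

variable {N V : Type*} [Fintype N] [Fintype V] [DecidableEq V] {n t m h : ℕ} {w : ℕ → ℝ}
  {C : ℕ → N → ℝ} {J : Finset V}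

/-- Supplies states with a given number of distinguished ads that contain a prescribed ad, inside or
outside `J`. -/
theorem exists_state (s : Finset V) (hs : s ⊆ J) {k : ℕ} (h1 : #s ≤ k) (h2 : k ≤ #J) :
    ∃ S : Finset V, Jᶜ ⊆ S ∧ s ⊆ S ∧ #(S ∩ J) = k := by
  obtain ⟨K, hsK, hKJ, hK⟩ := exists_subsuperset_card_eq hs h1 h2
  refine ⟨Jᶜ ∪ K, subset_union_left, hsK.trans subset_union_right, ?_⟩
  rw [union_inter_distrib_right, inter_comm Jᶜ J, inter_compl, empty_union, inter_eq_left.2 hKJ, hK]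

theorem IsThresholdReward.isPolicy (hC : IsThresholdReward n t m h w C) (ht : 1 ≤ t) :
    IsPolicy (uniformPolicy (IsOptimal t w C J)) :=
  isPolicy_uniformPolicy (exists_isOptimal ht hC.early) fun _ _ _ j h => h.1 j rfl

/-- Discarding is optimal while more than `h` stages above `t` remain; from then on a tied match
uses one distinguished ad per stage, in any order. -/
theorem IsThresholdReward.stateProb_pos_of_min (hC : IsThresholdReward n t m h w C) (ht : 1 ≤ t)
    (hJ : #J = h) (hth : h + t ≤ n) (u : ℕ) (hu : u + t ≤ n) (S : Finset V) (hS : Jᶜ ⊆ S)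
    (hcard : #(S ∩ J) = min h (n - u - t)) :
    0 < stateProb n (uniformPolicy (IsOptimal t w C J)) u S := by
  induction u generalizing S with
  | zero =>
    have h1 : S ∩ J = J := eq_of_subset_of_card_le inter_subset_right (by omega)
    have h2 : S = univ := eq_univ_of_forall fun j => by
      by_cases hj : j ∈ J
      · exact inter_eq_right.1 h1 hj
      · exact hS (mem_compl.2 hj)
    simp [stateProb, h2]
  | succ u ih =>
    have hn : n ≠ 0 := by omega
    by_cases hh : h ≤ n - (u + 1) - t
    · obtain ⟨i, -⟩ := hC.exists_pivot
      exact (hC.isPolicy ht).stateProb_succ_pos hn (a := none) (i := i)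
        (ih (by omega) S hS (by omega))
        (uniformPolicy_pos (isOptimal_none ht fun h => by omega))
    · obtain ⟨j, hjJ, hjS⟩ : ∃ j ∈ J, j ∉ S := by
        by_contra! hcon
        rw [inter_eq_right.2 hcon] at hcard
        omega
      have h1 := card_erase_inter_of_mem (mem_insert_self j S) hjJ
      rw [erase_insert hjS] at h1
      obtain ⟨i, hi⟩ := hC.exists_tie (n - u) (by omega)
      have h2 := (hC.isPolicy (J := J) ht).stateProb_succ_pos hn (a := some j) (i := i)
        (ih (by omega) (insert j S) (hS.trans (subset_insert _ _)) (by omega))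
        (uniformPolicy_pos (isOptimal_some_of_tie ht (by omega)
          (by rw [hi]; congr 1; omega) (mem_insert_self j S) hjJ))
      rwa [nextState_some, erase_insert hjS] at h2

/-- Such a state is reached in stage `t + m + 1` by the previous lemma, and is then kept by
discarding impressions of reward zero. -/
theorem IsThresholdReward.stateProb_pos_of_le (hC : IsThresholdReward n t m h w C) (ht : 1 ≤ t)
    (hJ : #J = h) (hth : h + t ≤ n) (hm : m + 1 ≤ h) (u : ℕ) (hu : n ≤ u + t + m + 1)
    (hun : u < n) (S : Finset V) (hS : Jᶜ ⊆ S) (hcard : #(S ∩ J) = m + 1) :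
    0 < stateProb n (uniformPolicy (IsOptimal t w C J)) u S := by
  by_cases hu' : n = u + t + m + 1
  · exact hC.stateProb_pos_of_min ht hJ hth u (by omega) S hS (by omega)
  induction u with
  | zero => omega
  | succ u ih =>
    have h1 : 0 < stateProb n (uniformPolicy (IsOptimal t w C J)) u S := by
      by_cases h2 : n = u + t + m + 1
      · exact hC.stateProb_pos_of_min ht hJ hth u (by omega) S hS (by omega)
      · exact ih (by omega) (by omega) h2
    obtain ⟨i, hi⟩ : ∃ i, n - u ≤ t + m → C (n - u) i = 0 := by
      by_cases h2 : n - u ≤ t + m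
      · obtain ⟨i, hi⟩ := hC.exists_zero _ h2
        exact ⟨i, fun _ => hi⟩
      · obtain ⟨i, -⟩ := hC.exists_pivot
        exact ⟨i, fun h3 => absurd h3 h2⟩
    exact (hC.isPolicy ht).stateProb_succ_pos (by omega) (a := none) (i := i) h1
      (uniformPolicy_pos (isOptimal_none ht fun h => hi (by omega)))

theorem IsThresholdReward.isFacetDefining (hC : IsThresholdReward n t m h w C)
    (hN : Fintype.card N = n) (hV : Fintype.card V = n) (ht : 1 ≤ t) (hJ : #J = h)
    (hth : h + t ≤ n) (hm1 : 1 ≤ m) (hm : m + 1 ≤ h) (f : MatchSpace N V n →ₗ[ℝ] ℝ)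
    (hf : ∀ z, f z = ∑ i, ∑ j, ∑ τ : Stage n, z i j τ * matchReward C J i j τ) :
    IsFacetDefining (achievable N V n) f (∑ u ∈ range h, w (u + 1)) := by
  classical
  have hn : n ≠ 0 := by omega
  have hn' : (0 : ℝ) < n := by exact_mod_cast Nat.pos_of_ne_zero hn
  obtain ⟨i₀, hi₀, hne_i₀⟩ := hC.exists_pivot
  have hzero : ∀ S, potential t w J 0 S = 0 := fun S => by
    rw [potential, show 0 + 1 - t = 0 by omega]
    simp
  have huniv : potential t w J n univ = ∑ u ∈ range h, w (u + 1) := by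
    rw [potential, univ_inter, hJ, min_eq_left (by omega)]
  have hb : ∑ u ∈ range h, w (u + 1) ≠ 0 := by
    have h1 := hC.sum_eq t le_rfl
    have h2 : 0 < ∑ i, C t i := sum_pos' (fun i _ => hC.nonneg t i)
      ⟨i₀, mem_univ _, lt_of_le_of_ne (hC.nonneg t i₀) hi₀.symm⟩
    rw [h1, show t + 1 - t = 0 + 1 by omega] at h2
    refine ne_of_gt (sum_pos' (f := fun u => w (u + 1)) (fun u _ => hC.weight_nonneg _ (by omega))
      ⟨0, mem_range.2 (show 0 < h by omega), pos_of_mul_pos_right h2 hn'.le⟩)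
  have htight : ∀ π : ℕ → Finset V → N → Option V → ℝ, IsPolicy π →
      (∀ τ S i a, π τ S i a ≠ 0 → IsOptimal t w C J τ S i a) →
      policyPoint n π ∈ {z ∈ achievable N V n | f z = ∑ u ∈ range h, w (u + 1)} := by
    intro π hπ hopt
    refine ⟨hπ.policyPoint_mem hV, ?_⟩
    rw [hf, ← huniv]
    exact hπ.sum_policyPoint_mul_eq hn hzero (fun τ S _ _ => hC.sum_stateValue hN τ S)
      fun τ S i a _ _ ha => (hopt τ S i a ha).2
  set π := uniformPolicy (IsOptimal t w C J) with hπdef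
  have hπ : IsPolicy π := hC.isPolicy ht
  refine isFacetDefining_of_dual hb zero_mem_achievable ?_ ⟨_, htight π hπ fun τ S i a =>
    of_uniformPolicy_ne_zero⟩ ?_
  · rintro z ⟨x, y, hxy, hz⟩
    rw [hf, ← huniv]
    simp only [hz]
    exact hxy.sum_mul_le hV hn hzero (fun τ S _ _ => hC.sum_stateValue hN τ S)
      hC.stateValue_nonneg (hC.potential_le_stateValue ht)
      fun τ S i j _ _ hj => hC.matchReward_add_le ht τ S i j hj
  · intro g hg
    let e : N → V → Stage n → MatchSpace N V n :=
      fun i j τ => Pi.single i (Pi.single j (Pi.single τ 1))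
    have he : ∀ i j τ, f (e i j τ) = matchReward C J i j τ := by
      intro i j τ
      rw [hf, sum_eq_single i, sum_eq_single j, sum_eq_single τ]
      · simp [e]
      · intro τ' _ h
        simp [e, h]
      · simp
      · intro j' _ h
        simp [e, h]
      · simp
      · intro i' _ h
        simp [e, h]
      · simp
    obtain ⟨j₀, hj₀⟩ : J.Nonempty := card_pos.1 (show 0 < #J by omega)
    let t' : Stage n := ⟨t, by rw [mem_Icc]; omega⟩
    -- The multiple is chosen to cancel the coefficient of `g` at the pivot impression, a fixed `j₀
    -- ∈ J` and stage `t`.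
    let g' : MatchSpace N V n →ₗ[ℝ] ℝ := g - (g (e i₀ j₀ t') / C t i₀) • f
    have hg'0 : g' (e i₀ j₀ t') = 0 := by
      simp only [g', LinearMap.sub_apply, LinearMap.smul_apply, he, matchReward, if_pos hj₀,
        smul_eq_mul]
      field_simp
      simp [t']
    have hg' : ∀ z ∈ {z ∈ achievable N V n | f z = ∑ u ∈ range h, w (u + 1)},
        ∀ z' ∈ {z ∈ achievable N V n | f z = ∑ u ∈ range h, w (u + 1)}, g' z = g' z' := by
      intro z hz z' hz'
      simp only [g', LinearMap.sub_apply, LinearMap.smul_apply, hz.2, hz'.2, hg z hz z' hz']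
    have hcompare : ∀ (τ : Stage n) (S : Finset V) (i : N) (a a' : Option V),
        (∀ i j (τ' : Stage n), (τ' : ℕ) < τ → g' (e i j τ') = 0) →
        0 < stateProb n π (n - τ) S → IsOptimal t w C J τ S i a → IsOptimal t w C J τ S i a' →
        a.elim 0 (fun j => g' (e i j τ)) = a'.elim 0 fun j => g' (e i j τ) := by
      intro τ S i a a' hlt hpos ha ha'
      have hdev : ∀ b, IsOptimal t w C J τ S i b → policyPoint n (deviate π τ S i b) ∈
          {z ∈ achievable N V n | f z = ∑ u ∈ range h, w (u + 1)} := by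
        intro b hb
        refine htight _ (hπ.deviate hb.1) fun τ' S' i' b' hb' => ?_
        unfold deviate at hb'
        split_ifs at hb' with h1 h2
        · obtain ⟨h3, rfl, rfl⟩ := h1
          rw [h3, h2]
          exact hb
        · exact absurd rfl hb'
        · exact of_uniformPolicy_ne_zero hb'
      have h1 := hg' _ (hdev a ha) _ (hdev a' ha')
      rw [linearMap_matchSpace_apply, linearMap_matchSpace_apply g', ← sub_eq_zero,
        sum_policyPoint_deviate_sub (fun i j τ => g' (e i j τ)) hlt] at h1
      have h2 : stateProb n π (n - τ) S / n ≠ 0 := (div_pos hpos hn').ne'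
      exact sub_eq_zero.1 ((mul_eq_zero.1 h1).resolve_left h2)
    have hall : ∀ k, ∀ τ : Stage n, (τ : ℕ) = k → ∀ i j, g' (e i j τ) = 0 := by
      intro k
      induction k using Nat.strong_induction_on with
      | _ k ih =>
      intro τ hτk i j
      have hτ := τ.2
      rw [mem_Icc] at hτ
      have hlt : ∀ i j (τ' : Stage n), (τ' : ℕ) < τ → g' (e i j τ') = 0 :=
        fun i j τ' h => ih _ (hτk ▸ h) τ' rfl i j
      have hs : ({j} : Finset V) ∩ J ⊆ J := inter_subset_right
      have hs1 : #(({j} : Finset V) ∩ J) ≤ 1 :=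
        (card_le_card inter_subset_left).trans (card_singleton j).le
      have hmem : ∀ S : Finset V, Jᶜ ⊆ S → {j} ∩ J ⊆ S → j ∈ S := by
        intro S h1 h2
        by_cases hj : j ∈ J
        · exact h2 (by simp [hj])
        · exact h1 (by simpa using hj)
      -- Matching to `J` can tie with discarding when the reward is zero or equals the marginal
      -- value of an ad. Only the pivot in stage `t` escapes.
      have hcases : (C τ i = 0 ∧ τ ≤ t + m) ∨ (t < τ ∧ C τ i = w (min h (τ - t)))
          ∨ ((τ : ℕ) = t ∧ i = i₀) := by
        rcases lt_trichotomy (τ : ℕ) t with h1 | h1 | h1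
        · exact Or.inl ⟨hC.early _ _ h1, by omega⟩
        · by_cases hi : i = i₀
          · exact Or.inr (Or.inr ⟨h1, hi⟩)
          · exact Or.inl ⟨h1 ▸ hne_i₀ i hi, by omega⟩
        · rcases hC.tie_or_zero τ i h1 with h2 | h2
          · exact Or.inr (Or.inl ⟨h1, h2⟩)
          · exact Or.inl h2
      rcases hcases with ⟨h1, h2⟩ | ⟨h1, h2⟩ | ⟨h1, rfl⟩
      -- Since `τ + 1 - t ≤ m + 1`, a match to `J` from this state costs nothing, and it earns
      -- nothing.
      · obtain ⟨S, hS1, hS2, hS3⟩ := exists_state _ hs (k := m + 1) (by omega) (by omega)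
        refine hcompare τ S i (some j) none hlt
          (hC.stateProb_pos_of_le ht hJ hth hm _ (by omega) (by omega) S hS1 hS3) ?_
          (isOptimal_none ht fun _ => h1)
        by_cases hj : j ∈ J
        · exact isOptimal_some_of_le ht (by omega) (hmem S hS1 hS2) hj
        · exact isOptimal_some_of_notMem ht (fun _ => h1) (hmem S hS1 hS2) hj
      · obtain ⟨S, hS1, hS2, hS3⟩ := exists_state _ hs (k := min h (τ - t)) (by omega) (by omega)
        refine hcompare τ S i (some j) none hlt
          (hC.stateProb_pos_of_min ht hJ hth _ (by omega) S hS1 (by omega)) ?_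
          (isOptimal_none ht fun _ => by omega)
        by_cases hj : j ∈ J
        · exact isOptimal_some_of_tie ht (by omega) (by rw [h2, hS3]) (hmem S hS1 hS2) hj
        · exact isOptimal_some_of_notMem ht (fun _ => by omega) (hmem S hS1 hS2) hj
      · by_cases hj : j ∈ J
        -- With an ad of `J` left, discarding the pivot is never optimal in stage `t`, so two
        -- matches are compared; `m ≥ 1` leaves room for both `j` and `j₀`.
        · obtain ⟨S, hS1, hS2, hS3⟩ := exists_state {j, j₀}
            (insert_subset hj (singleton_subset_iff.2 hj₀)) (k := m + 1)
            (card_le_two.trans (by omega)) (by omega)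
          have h2 := hcompare τ S i (some j) (some j₀) hlt
            (hC.stateProb_pos_of_le ht hJ hth hm _ (by omega) (by omega) S hS1 hS3)
            (isOptimal_some_of_le ht (by omega) (hS2 (by simp)) hj)
            (isOptimal_some_of_le ht (by omega) (hS2 (by simp)) hj₀)
          have h3 : τ = t' := Subtype.ext h1
          simp only [Option.elim_some, h3, hg'0] at h2
          rw [h3]
          exact h2
        -- Once `J` is exhausted, nothing can be earned and all legal actions tie.
        · obtain ⟨S, hS1, -, hS3⟩ := exists_state ∅ (empty_subset J) (k := 0) (by simp) (by omega)
          exact hcompare τ S i (some j) none hlt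
            (hC.stateProb_pos_of_min ht hJ hth _ (by omega) S hS1 (by omega))
            (isOptimal_some_of_notMem ht (fun _ => by omega) (hS1 (by simpa using hj)) hj)
            (isOptimal_none ht fun _ => by omega)
    refine ⟨g (e i₀ j₀ t') / C t i₀, sub_eq_zero.1 (LinearMap.ext fun z => ?_)⟩
    change g' z = 0
    rw [linearMap_matchSpace_apply]
    exact sum_eq_zero fun i _ => sum_eq_zero fun j _ => sum_eq_zero fun τ _ => by
      rw [hall τ τ rfl i j, mul_zero]

end Main

/-! ### The rewards of the stated inequality. -/

open Classical in
/-- The reward of matching impression `i` in stage `τ` to a distinguished ad: it is `r` before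
stage `t + m`, it is `n` on `I` in stage `t + m`, and a power of `n` on a single impression in each
of the following `m` stages. -/
noncomputable def facetReward {N : Type*} (n r t m : ℕ) (I : Finset N) (ι : ℕ → N) (τ : ℕ)
    (i : N) : ℝ :=
  if τ < t then 0
  else if τ < t + m then (if i = ι τ then (n : ℝ) ^ (t + m + 1 - τ) else 0)
  else if τ = t + m then (if i ∈ I then (n : ℝ) else 0)
  else r

/-- The value of the `k`-th remaining distinguished ad. -/
noncomputable def facetWeight (n r m k : ℕ) : ℝ := if k ≤ m then (n : ℝ) ^ (m + 1 - k) else r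

/-- In each stage `τ > t` the nonzero reward is the single number `w (min h (τ - t))`, and `w` is
nonincreasing because `r ≤ n`. The condition `r < n` provides an impression outside `I`, hence one
of reward zero in stage `t + m`. -/
theorem isThresholdReward_facetReward {N : Type*} [Fintype N] {n r t m h : ℕ}
    (hN : Fintype.card N = n) (hr : 1 ≤ r) (hrn : r < n) (hm : 1 ≤ m) (hmh : m + 1 ≤ h)
    {I : Finset N} (hI : #I = r) (ι : ℕ → N) :
    IsThresholdReward n t m h (facetWeight n r m) (facetReward n r t m I ι) := by
  classical
  have hn1 : (1 : ℝ) ≤ n := by exact_mod_cast (by omega : 1 ≤ n)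
  have hrn' : (r : ℝ) ≤ n := by exact_mod_cast hrn.le
  have hpow : ∀ k, k ≤ m → (n : ℝ) ≤ n ^ (m + 1 - k) := fun k hk =>
    le_self_pow₀ hn1 (by omega)
  have hne : ∀ i : N, ∃ i', i' ≠ i := fun i => by
    have : Nontrivial N := Fintype.one_lt_card_iff_nontrivial.1 (by omega)
    exact exists_ne i
  obtain ⟨i₁, hi₁⟩ : I.Nonempty := card_pos.1 (by omega)
  obtain ⟨i₂, hi₂⟩ : ∃ i, i ∉ I := by
    by_contra! hcon
    rw [eq_univ_of_forall hcon, card_univ] at hI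
    omega
  refine ⟨fun τ i => ?_, fun τ i hτ => if_pos hτ, fun τ hτ => ?_, fun τ i k hk hkτ => ?_,
    fun τ hτ => ?_, fun τ hτ => ?_, fun τ i hτ => ?_, ι t, ?_, fun i hi => ?_⟩
  · unfold facetReward
    split_ifs <;> positivity
  · simp only [facetReward, if_neg (not_lt.2 hτ), facetWeight]
    rcases lt_trichotomy τ (t + m) with h1 | h1 | h1
    · simp only [if_pos h1, sum_ite_eq', mem_univ, if_true]
      rw [if_pos (by omega), ← pow_succ']
      congr 1
      omega
    · simp only [if_neg h1.not_lt, if_pos h1]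
      rw [if_neg (by omega), sum_ite_mem, univ_inter, sum_const, hI, nsmul_eq_mul, mul_comm]
    · simp only [if_neg h1.le.not_gt, if_neg h1.ne']
      rw [if_neg (by omega), sum_const, card_univ, hN, nsmul_eq_mul]
  · have hw : (r : ℝ) ≤ facetWeight n r m k := by
      unfold facetWeight
      split_ifs with h1
      · exact hrn'.trans (hpow k h1)
      · exact le_rfl
    have hw0 : 0 ≤ facetWeight n r m k := r.cast_nonneg.trans hw
    unfold facetReward
    split_ifs with h1 h2 h3 h4 h5
    · exact hw0
    · rw [facetWeight, if_pos (by omega)]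
      exact pow_le_pow_right₀ hn1 (by omega)
    · exact hw0
    · rw [facetWeight, if_pos (by omega)]
      exact hpow k (by omega)
    · exact hw0
    · exact hw
  · simp only [facetReward, if_neg (not_lt.2 hτ.le), facetWeight]
    rcases lt_trichotomy τ (t + m) with h1 | h1 | h1
    · refine ⟨ι τ, ?_⟩
      rw [if_pos h1, if_pos rfl, if_pos (by omega)]
      congr 1
      omega
    · refine ⟨i₁, ?_⟩
      rw [if_neg h1.not_lt, if_pos h1, if_pos hi₁, if_pos (by omega),
        show m + 1 - min h (τ - t) = 1 by omega, pow_one]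
    · refine ⟨i₁, ?_⟩
      rw [if_neg h1.le.not_gt, if_neg h1.ne', if_neg (by omega)]
  · unfold facetReward
    rcases lt_or_eq_of_le hτ with h1 | h1
    · obtain ⟨i, hi⟩ := hne (ι τ)
      exact ⟨i, by simp [hi, h1]⟩
    · refine ⟨i₂, ?_⟩
      rw [if_neg (by omega), if_neg h1.not_lt, if_pos h1, if_neg hi₂]
  · simp only [facetReward, if_neg (not_lt.2 hτ.le), facetWeight]
    rcases lt_trichotomy τ (t + m) with h1 | h1 | h1
    · by_cases hi : i = ι τ
      · left
        rw [if_pos h1, if_pos hi, if_pos (by omega)]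
        congr 1
        omega
      · right
        rw [if_pos h1, if_neg hi]
        exact ⟨rfl, h1.le⟩
    · by_cases hi : i ∈ I
      · left
        rw [if_neg h1.not_lt, if_pos h1, if_pos hi, if_pos (by omega),
          show m + 1 - min h (τ - t) = 1 by omega, pow_one]
      · right
        rw [if_neg h1.not_lt, if_pos h1, if_neg hi]
        exact ⟨rfl, h1.le⟩
    · left
      rw [if_neg h1.le.not_gt, if_neg h1.ne', if_neg (by omega)]
  · rw [facetReward, if_neg (lt_irrefl t), if_pos (by omega), if_pos rfl]
    positivity
  · rw [facetReward, if_neg (lt_irrefl t), if_pos (by omega), if_neg hi]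

theorem Zsum_apply {N V : Type*} {n : ℕ} (I : Finset N) (J : Finset V) (τ : ℕ)
    (z : MatchSpace N V n) :
    Zsum I J τ z = ∑ i ∈ I, ∑ j ∈ J, if hτ : τ ∈ Icc 1 n then z i j ⟨τ, hτ⟩ else 0 := rfl

-- Brings each of the three sums of the inequality to the form of a total reward.
open Classical in
theorem sum_smul_Zsum {N V : Type*} [Fintype N] [Fintype V] {n : ℕ} (A : Finset ℕ)
    (hA : A ⊆ Icc 1 n) (I : ℕ → Finset N) (J : Finset V) (b : ℕ → ℝ) (z : MatchSpace N V n) :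
    ∑ τ ∈ A, b τ * Zsum (I τ) J τ z = ∑ i, ∑ j, ∑ τ : Stage n, z i j τ *
      if j ∈ J then (if (τ : ℕ) ∈ A ∧ i ∈ I τ then b τ else 0) else 0 := by
  have h1 : ∑ τ ∈ A, b τ * Zsum (I τ) J τ z
      = ∑ τ : Stage n, if (τ : ℕ) ∈ A then b τ * Zsum (I τ) J τ z else 0 := by
    rw [sum_coe_sort (Icc 1 n) fun τ => if τ ∈ A then b τ * Zsum (I τ) J τ z else 0, sum_ite_mem,
      inter_eq_right.2 hA]
  have h2 : ∑ i, ∑ j, ∑ τ : Stage n, z i j τ *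
        (if j ∈ J then (if (τ : ℕ) ∈ A ∧ i ∈ I τ then b τ else 0) else 0)
      = ∑ τ : Stage n, ∑ i, ∑ j, z i j τ *
        if j ∈ J then (if (τ : ℕ) ∈ A ∧ i ∈ I τ then b τ else 0) else 0 := by
    rw [sum_congr rfl fun i _ => sum_comm, sum_comm]
  rw [h1, h2]
  refine sum_congr rfl fun τ _ => ?_
  split_ifs with hτ
  · have h3 : ∀ i, ∑ j, z i j τ * (if j ∈ J then (if (τ : ℕ) ∈ A ∧ i ∈ I τ then b τ else 0) else 0)
        = if i ∈ I τ then ∑ j ∈ J, b τ * z i j τ else 0 := by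
      intro i
      simp only [mul_ite, mul_zero, sum_ite_mem, univ_inter, hτ, true_and]
      split_ifs
      · simp only [mul_comm]
      · simp
    simp only [h3, sum_ite_mem, univ_inter, Zsum_apply, τ.2, dite_true, mul_sum]
  · simp [hτ]

theorem sum_facetWeight {n r m h q : ℕ} (hh : h = m + q + 1) :
    ∑ u ∈ range h, facetWeight n r m (u + 1)
      = (r : ℝ) * (q + 1) + ∑ τ ∈ Icc 1 m, (n : ℝ) ^ (m + 1 - τ) := by
  rw [hh, add_assoc, sum_range_add, add_comm]
  congr 1
  · rw [sum_congr rfl fun u _ => show facetWeight n r m (m + u + 1) = r from if_neg (by omega),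
      sum_const, card_range, nsmul_eq_mul, mul_comm]
    push_cast
    ring
  · rw [range_eq_Ico, sum_Ico_add' (facetWeight n r m) 0 m 1]
    refine sum_congr rfl fun u hu => ?_
    replace hu := mem_Icc.1 hu
    exact if_pos (by omega)

theorem mainTheorem3 {N V : Type*} [Fintype N] [Fintype V] [DecidableEq V] (n : ℕ)
    (hN : Fintype.card N = n) (hV : Fintype.card V = n)
    (h r t q : ℕ) (hh : h ∈ Icc 2 (n - 1)) (hr : r ∈ Icc 1 (n - 1)) (ht : t ∈ Icc 1 (n - h))
    (hq : q ∈ Icc 0 (h - 2))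
    (J : Finset V) (hJ : #J = h) (I : Finset N) (hI : #I = r) (i : ℕ → N) :
    IsFacetDefining (achievable N V n)
      ((r : ℝ) • ∑ τ ∈ Icc (t + h - q) n, Zsum univ J τ
        + (n : ℝ) • Zsum I J (t + h - q - 1)
        + ∑ τ ∈ Icc t (t + h - q - 2), (n : ℝ) ^ (t + h - q - τ) • Zsum {i τ} J τ)
      ((r : ℝ) * (q + 1) + ∑ τ ∈ Icc 1 (h - q - 1), (n : ℝ) ^ (h - q - τ)) := by
  classical
  rw [mem_Icc] at hh hr ht hq
  -- `m` counts the stages `t, ..., t + m - 1` with a single rewarded impression; `q ≤ h - 2` makes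
  -- it positive.
  obtain ⟨m, hm⟩ : ∃ m, h = m + q + 1 := ⟨h - q - 1, by omega⟩
  have hC := isThresholdReward_facetReward (t := t) (h := h) hN hr.1 (by omega)
    (by omega : 1 ≤ m) (by omega) hI i
  have e1 : t + h - q = t + m + 1 := by omega
  have e2 : h - q = m + 1 := by omega
  have e3 : t + m + 1 - 2 = t + m - 1 := by omega
  rw [e1, e2, e3, Nat.add_sub_cancel, Nat.add_sub_cancel, ← sum_facetWeight hm]
  refine hC.isFacetDefining hN hV ht.1 hJ (by omega) (by omega) (by omega) _ fun z => ?_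
  have s1 := sum_smul_Zsum (Icc (t + m + 1) n) (Icc_subset_Icc_left (by omega))
    (fun _ => (univ : Finset N)) J (fun _ => (r : ℝ)) z
  have s2 := sum_smul_Zsum {t + m} (singleton_subset_iff.2 (by rw [mem_Icc]; omega))
    (fun _ => I) J (fun _ => (n : ℝ)) z
  have s3 := sum_smul_Zsum (Icc t (t + m - 1)) (Icc_subset_Icc (by omega) (by omega))
    (fun τ => {i τ}) J (fun τ => (n : ℝ) ^ (t + m + 1 - τ)) z
  simp only [LinearMap.add_apply, LinearMap.smul_apply, LinearMap.sum_apply, smul_eq_mul]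
  rw [sum_singleton] at s2
  rw [mul_sum, s1, s2, s3]
  simp only [← sum_add_distrib, ← mul_add]
  refine sum_congr rfl fun i' _ => sum_congr rfl fun j _ => sum_congr rfl fun τ _ => ?_
  have hτ := τ.2
  rw [mem_Icc] at hτ
  congr 1
  rw [matchReward]
  by_cases hj : j ∈ J
  · simp only [if_pos hj, facetReward, mem_Icc, mem_singleton, mem_univ, and_true, hτ.2]
    rcases lt_trichotomy (τ : ℕ) (t + m) with h1 | h1 | h1
    · have f1 : ¬ t + m + 1 ≤ (τ : ℕ) := by omega
      have f2 : (τ : ℕ) ≤ t + m - 1 := by omega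
      by_cases h2 : (τ : ℕ) < t
      · simp [f1, h1.ne, h2]
      · simp [f1, f2, h1, h1.ne, h2, not_lt.1 h2]
    · have f1 : ¬ t + m ≤ t + m - 1 := by omega
      simp [h1, f1]
    · have f1 : ¬ (τ : ℕ) ≤ t + m - 1 := by omega
      have f2 : ¬ (τ : ℕ) < t := by omega
      simp [Nat.succ_le_of_lt h1, h1.ne', h1.le.not_gt, f1, f2]
  · simp [hj]
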